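/- Let $\mathcal{E}$ be an exact category in the sense of Quillen: an additive category with an isomorphism-closed class of kernel-cokernel pairs $0\to X\xrightarrow{i}Y\xrightarrow{d}Z\to 0$, called conflations, such that inflations (the maps $i$ that occur) and deflations (the maps $d$ that occur) contain the identities, are closed under composition, and inflations have pushouts, and deflations have pullbacks, along arbitrary morphisms, which are again inflations, respectively deflations. A weak factorization system is a pair $(\mathcal{L},\mathcal{R})$ of classes of morphisms of $\mathcal{E}$, both closed under retracts, such that every $f\in\mathcal{L}$ has the left lifting property for every $g\in\mathcal{R}$ and every morphism $h$ factors as $h=gf$ with $f\in\mathcal{L}$ and $g\in\mathcal{R}$. It is functorial if the factorization can be chosen functorially in $h$. It is exact if, for every morphism $f$: $f\in\mathcal{L}$ if and only if $f$ is an inflation and $0\to\operatorname{Coker}f$ is in $\mathcal{L}$; and $f\in\mathcal{R}$ if and only if $f$ is a deflation and $\operatorname{Ker}f\to0$ is in $\mathcal{R}$. A complete cotorsion pair is a pair $(\mathcal{A},\mathcal{B})$ of classes of objects such that $\mathcal{A}=\{A\mid\operatorname{Ext}^1_{\mathcal{E}}(A,B)=0\ \forall B\in\mathcal{B}\}$ and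 $\mathcal{B}=\{B\mid\operatorname{Ext}^1_{\mathcal{E}}(A,B)=0\ \forall A\in\mathcal{A}\}$ (Yoneda's $\operatorname{Ext}^1$), and such that every object $X$ admits conflations $0\to X\to B_X\to A_X\to0$ and $0\to B^X\to A^X\to X\to0$ with $A_X,A^X\in\mathcal{A}$ and $B_X,B^X\in\mathcal{B}$. It is functorially complete if these conflations can be chosen functorially in $X$. Let $\operatorname{Coker}\mathcal{L}$ be the class of objects isomorphic to $\operatorname{Coker}f$ for some inflation $f\in\mathcal{L}$, and $\operatorname{Ker}\mathcal{R}$ the class of objects isomorphic to $\operatorname{Ker}f$ for some deflation $f\in\mathcal{R}$. Let $\operatorname{Infl}\mathcal{A}$ be the class of inflations with cokernel in $\mathcal{A}$, and $\operatorname{Defl}\mathcal{B}$ the class of deflations with kernel in $\mathcal{B}$. Put $\Phi(\mathcal{L},\mathcal{R})=(\operatorname{Coker}\mathcal{L},\operatorname{Ker}\mathcal{R})$ and $\Psi(\mathcal{A},\mathcal{B})=(\operatorname{Infl}\mathcal{A},\operatorname{Defl}\mathcal{B})$. Then: 1. $\Phi$ sends exact weak factorization systems to complete cotorsion pairs, and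 exact functorial weak factorization systems to functorially complete cotorsion pairs. Moreover $\Psi(\Phi(\mathcal{L},\mathcal{R}))=(\mathcal{L},\mathcal{R})$ for every exact weak factorization system $(\mathcal{L},\mathcal{R})$, and $\Phi(\Psi(\mathcal{A},\mathcal{B}))=(\mathcal{A},\mathcal{B})$ for every complete cotorsion pair $(\mathcal{A},\mathcal{B})$. 2. If $\mathcal{E}$ is weakly idempotent complete (every section, that is, every split monomorphism, has a cokernel), then $\Phi$ and $\Psi$ are mutually inverse bijections between the exact weak factorization systems and the complete cotorsion pairs, and they restrict to mutually inverse bijections between the exact functorial weak factorization systems and the functorially complete cotorsion pairs. -/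

import Mathlib

open CategoryTheory CategoryTheory.Limits
open scoped ZeroObject

universe v u

namespace QuillenExact

section Axioms

variable {C : Type u} [Category.{v} C] [Preadditive C]

/-- The morphisms `i` that occur as the first map of a sequence `X ⟶ Y ⟶ Z` in the class `P`. -/
def firstMaps (P : ObjectProperty (ShortComplex C)) : MorphismProperty C :=
  fun _ Y i => ∃ (Z : C) (d : Y ⟶ Z) (w : i ≫ d = 0), P (ShortComplex.mk i d w)

/-- The morphisms `d` that occur as the second map of a sequence `X ⟶ Y ⟶ Z` in the class `P`. -/
def secondMaps (P : ObjectProperty (ShortComplex C)) : MorphismProperty C :=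
  fun Y _ d => ∃ (X : C) (i : X ⟶ Y) (w : i ≫ d = 0), P (ShortComplex.mk i d w)

end Axioms

/-- A (Quillen) exact structure on an additive category: an isomorphism-closed class of
kernel-cokernel pairs, the conflations, such that inflations (first maps of conflations) and
deflations (second maps of conflations) contain identities, are closed under composition, and are
stable under pushouts respectively pullbacks, which are required to exist. -/
structure ExactStructure (C : Type u) [Category.{v} C] [Preadditive C]
    [HasFiniteBiproducts C] where
  /-- the class of conflations -/
  conflation : ObjectProperty (ShortComplex C)
  conflation_of_iso : ∀ {S T : ShortComplex C}, (S ≅ T) → conflation S → conflation T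
  isKernel : ∀ {S : ShortComplex C}, conflation S → Nonempty (IsLimit (KernelFork.ofι S.f S.zero))
  isCokernel : ∀ {S : ShortComplex C}, conflation S →
    Nonempty (IsColimit (CokernelCofork.ofπ S.g S.zero))
  id_inflation : ∀ X : C, firstMaps conflation (𝟙 X)
  id_deflation : ∀ X : C, secondMaps conflation (𝟙 X)
  comp_inflation : ∀ {X Y Z : C} (f : X ⟶ Y) (g : Y ⟶ Z),
    firstMaps conflation f → firstMaps conflation g → firstMaps conflation (f ≫ g)
  comp_deflation : ∀ {X Y Z : C} (f : X ⟶ Y) (g : Y ⟶ Z),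
    secondMaps conflation f → secondMaps conflation g → secondMaps conflation (f ≫ g)
  pushout_inflation : ∀ {X Y X' : C} (f : X ⟶ Y) (a : X ⟶ X'), firstMaps conflation f →
    ∃ (Y' : C) (b : Y ⟶ Y') (f' : X' ⟶ Y'), IsPushout f a b f' ∧ firstMaps conflation f'
  pullback_deflation : ∀ {Y Z Z' : C} (g : Y ⟶ Z) (c : Z' ⟶ Z), secondMaps conflation g →
    ∃ (Y' : C) (b : Y' ⟶ Y) (g' : Y' ⟶ Z'), IsPullback b g' g c ∧ secondMaps conflation g'

/-- A category (with zero morphisms) is weakly idempotent complete if every section has a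
cokernel. -/
def IsWeaklyIdempotentComplete (C : Type u) [Category.{v} C] [HasZeroMorphisms C] : Prop :=
  ∀ {X Y : C} (s : X ⟶ Y), IsSplitMono s → HasCokernel s

section WeakFactorization

variable {C : Type u} [Category.{v} C]

/-- Weak factorization systems. -/
structure IsWFS (L R : MorphismProperty C) : Prop where
  retract_left : L.IsStableUnderRetracts
  retract_right : R.IsStableUnderRetracts
  lifting : ∀ {A B X Y : C} (f : A ⟶ B) (g : X ⟶ Y), L f → R g → HasLiftingProperty f g
  factorization : L.HasFactorization R

/-- This notion of weak factorization system agrees with the one in Mathlib. -/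
theorem isWFS_iff (L R : MorphismProperty C) :
    IsWFS L R ↔ MorphismProperty.IsWeakFactorizationSystem L R := by
  constructor
  · rintro ⟨h1, h2, h3, h4⟩
    exact .mk' L R h3
  · intro h
    exact ⟨h.llp ▸ inferInstance, h.rlp ▸ inferInstance,
      fun f g hf hg => MorphismProperty.hasLiftingProperty_of_wfs f g hf hg, h.hasFactorization⟩

end WeakFactorization

namespace ExactStructure

variable {C : Type u} [Category.{v} C] [Preadditive C] [HasFiniteBiproducts C]
variable (E : ExactStructure C)

/-- The class of inflations. -/
def inflation : MorphismProperty C := firstMaps E.conflation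

/-- The class of deflations. -/
def deflation : MorphismProperty C := secondMaps E.conflation

/-- A conflation `0 ⟶ Y ⟶ M ⟶ X ⟶ 0`, regarded as an extension of `X` by `Y`. -/
structure Extension (X Y : C) where
  /-- the middle term -/
  M : C
  /-- the inflation -/
  i : Y ⟶ M
  /-- the deflation -/
  d : M ⟶ X
  w : i ≫ d = 0
  conflation : E.conflation (ShortComplex.mk i d w)

/-- There is a morphism of extensions that is the identity on both end terms. -/
def Extension.Rel {X Y : C} (ε ε' : E.Extension X Y) : Prop :=
  ∃ φ : ε.M ⟶ ε'.M, ε.i ≫ φ = ε'.i ∧ φ ≫ ε'.d = ε.d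

/-- Yoneda's `Ext¹(X, Y)`: extensions of `X` by `Y` modulo the equivalence relation generated
by morphisms of extensions which are the identity on both end terms. -/
def Ext1 (X Y : C) : Type max u v := Quot (Extension.Rel E (X := X) (Y := Y))

/-- `Ext¹(X, Y) = 0`: the (never empty) collection `Ext¹(X, Y)` has exactly one element. -/
def Ext1Vanishes (X Y : C) : Prop := Subsingleton (E.Ext1 X Y)

/-- The right orthogonal class `S^⊥` with respect to `Ext¹`. -/
def rightPerp (S : ObjectProperty C) : ObjectProperty C :=
  fun B => ∀ A : C, S A → E.Ext1Vanishes A B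

/-- The left orthogonal class `^⊥S` with respect to `Ext¹`. -/
def leftPerp (S : ObjectProperty C) : ObjectProperty C :=
  fun A => ∀ B : C, S B → E.Ext1Vanishes A B

/-- Complete cotorsion pairs. -/
structure IsCompleteCotorsionPair (A B : ObjectProperty C) : Prop where
  left_eq : A = E.leftPerp B
  right_eq : E.rightPerp A = B
  approx_right : ∀ X : C, ∃ (BX AX : C) (i : X ⟶ BX) (d : BX ⟶ AX) (w : i ≫ d = 0),
    E.conflation (ShortComplex.mk i d w) ∧ A AX ∧ B BX
  approx_left : ∀ X : C, ∃ (BX AX : C) (i : BX ⟶ AX) (d : AX ⟶ X) (w : i ≫ d = 0),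
    E.conflation (ShortComplex.mk i d w) ∧ A AX ∧ B BX

/-- Complete cotorsion pairs whose approximation sequences, of both kinds, can be chosen
functorially. -/
structure IsFunctoriallyCompleteCotorsionPair (A B : ObjectProperty C) : Prop
    extends E.IsCompleteCotorsionPair A B where
  functorial_right : ∃ (FB FA : C ⥤ C) (i : 𝟭 C ⟶ FB) (d : FB ⟶ FA)
    (w : ∀ X : C, i.app X ≫ d.app X = 0), ∀ X : C,
      E.conflation (ShortComplex.mk (i.app X) (d.app X) (w X)) ∧ A (FA.obj X) ∧ B (FB.obj X)
  functorial_left : ∃ (FB FA : C ⥤ C) (i : FB ⟶ FA) (d : FA ⟶ 𝟭 C)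
    (w : ∀ X : C, i.app X ≫ d.app X = 0), ∀ X : C,
      E.conflation (ShortComplex.mk (i.app X) (d.app X) (w X)) ∧ A (FA.obj X) ∧ B (FB.obj X)

/-- Exact weak factorization systems: `f ∈ L` iff `f` is an inflation and `0 ⟶ Coker f` is in `L`,
and `f ∈ R` iff `f` is a deflation and `Ker f ⟶ 0` is in `R`. -/
structure IsExactWFS (L R : MorphismProperty C) : Prop extends IsWFS L R where
  left_iff : ∀ {X Y : C} (f : X ⟶ Y), L f ↔
    ∃ (Z : C) (d : Y ⟶ Z) (w : f ≫ d = 0),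
      E.conflation (ShortComplex.mk f d w) ∧ L (0 : (0 : C) ⟶ Z)
  right_iff : ∀ {Y Z : C} (f : Y ⟶ Z), R f ↔
    ∃ (X : C) (i : X ⟶ Y) (w : i ≫ f = 0),
      E.conflation (ShortComplex.mk i f w) ∧ R (0 : X ⟶ (0 : C))

/-- Exact functorial weak factorization systems. -/
structure IsExactFunctorialWFS (L R : MorphismProperty C) : Prop extends E.IsExactWFS L R where
  functorial : L.HasFunctorialFactorization R

/-- `Coker L`: the objects isomorphic to the cokernel of some inflation in `L`. -/
def cokerClass (L : MorphismProperty C) : ObjectProperty C :=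
  fun A => ∃ (X Y Z : C) (f : X ⟶ Y) (d : Y ⟶ Z) (w : f ≫ d = 0),
    L f ∧ E.conflation (ShortComplex.mk f d w) ∧ Nonempty (A ≅ Z)

/-- `Ker R`: the objects isomorphic to the kernel of some deflation in `R`. -/
def kerClass (R : MorphismProperty C) : ObjectProperty C :=
  fun B => ∃ (X Y Z : C) (i : X ⟶ Y) (f : Y ⟶ Z) (w : i ≫ f = 0),
    R f ∧ E.conflation (ShortComplex.mk i f w) ∧ Nonempty (B ≅ X)

/-- `Infl A`: the inflations with cokernel in `A`. -/
def inflClass (A : ObjectProperty C) : MorphismProperty C :=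
  fun _ Y f => ∃ (Z : C) (d : Y ⟶ Z) (w : f ≫ d = 0), E.conflation (ShortComplex.mk f d w) ∧ A Z

/-- `Defl B`: the deflations with kernel in `B`. -/
def deflClass (B : ObjectProperty C) : MorphismProperty C :=
  fun Y _ f => ∃ (X : C) (i : X ⟶ Y) (w : i ≫ f = 0), E.conflation (ShortComplex.mk i f w) ∧ B X

/-- The assignment `(L, R) ↦ (Coker L, Ker R)`. -/
def cokerKer (p : MorphismProperty C × MorphismProperty C) :
    ObjectProperty C × ObjectProperty C :=
  (E.cokerClass p.1, E.kerClass p.2)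

/-- The assignment `(A, B) ↦ (Infl A, Defl B)`. -/
def inflDefl (p : ObjectProperty C × ObjectProperty C) :
    MorphismProperty C × MorphismProperty C :=
  (E.inflClass p.1, E.deflClass p.2)

/-- All exact weak factorization systems. -/
def exactWFS : Set (MorphismProperty C × MorphismProperty C) :=
  {p | E.IsExactWFS p.1 p.2}

/-- All exact functorial weak factorization systems. -/
def exactFunctorialWFS : Set (MorphismProperty C × MorphismProperty C) :=
  {p | E.IsExactFunctorialWFS p.1 p.2}

/-- All complete cotorsion pairs. -/
def completeCotorsionPairs : Set (ObjectProperty C × ObjectProperty C) :=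
  {p | E.IsCompleteCotorsionPair p.1 p.2}

/-- All functorially complete cotorsion pairs. -/
def functoriallyCompleteCotorsionPairs : Set (ObjectProperty C × ObjectProperty C) :=
  {p | E.IsFunctoriallyCompleteCotorsionPair p.1 p.2}

end ExactStructure

end QuillenExact

/-! The bridge between the two notions is the equivalence of lifting properties with vanishing of
`Ext¹`. If `f` is an inflation with cokernel `A`, `g` a deflation with kernel `B` and `Ext¹(A, B) =
0`, then `f` lifts against `g` (`hasLiftingProperty_of_ext1Vanishes`); conversely, lifting against
all of `Defl B` forces the cokernel of an inflation into `^⊥B`, and dually. Exactness of a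
factorization system says that it is determined by the maps `0 ⟶ A` in `L` and `B ⟶ 0` in `R`;
factoring `0 ⟶ X` and `X ⟶ 0` gives the approximation sequences, and the retract argument gives the
orthogonality equalities.

Conversely, to factor `f : X ⟶ Y` by a complete cotorsion pair, choose a deflation `A₁ ⟶ Y` with
`A₁` in `A`, so that `X ⊞ A₁ ⟶ Y` is a deflation, and push out along an embedding of its kernel `K`
into some `B₂` in `B` with cokernel in `A`. Every choice beyond the approximations is a biproduct,
kernel or pushout, hence functorial. Weak idempotent completeness enters only to show that retracts
of inflations and deflations are again such. -/

namespace QuillenExact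

namespace ExactStructure

variable {C : Type u} [Category.{v} C] [Preadditive C] [HasFiniteBiproducts C]
variable (E : ExactStructure C)

attribute [local instance] hasBinaryBiproducts_of_finite_biproducts

/-- The morphisms `i` and `d` form a conflation. -/
def IsConflation {X Y Z : C} (i : X ⟶ Y) (d : Y ⟶ Z) : Prop :=
  ∃ w : i ≫ d = 0, E.conflation (ShortComplex.mk i d w)

variable {E}

/-! ### Calculus of conflations: uniqueness, pushouts, pullbacks, splitting -/

namespace IsConflation

variable {X Y Z : C} {i : X ⟶ Y} {d : Y ⟶ Z}

lemma w (h : E.IsConflation i d) : i ≫ d = 0 := h.choose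

lemma exists_lift (h : E.IsConflation i d) {T : C} (k : T ⟶ Y) (hk : k ≫ d = 0) :
    ∃ l : T ⟶ X, l ≫ i = k := by
  obtain ⟨w, h⟩ := h
  obtain ⟨hl⟩ := E.isKernel h
  exact ⟨_, (KernelFork.IsLimit.lift' hl k hk).2⟩

lemma exists_desc (h : E.IsConflation i d) {T : C} (k : Y ⟶ T) (hk : i ≫ k = 0) :
    ∃ l : Z ⟶ T, d ≫ l = k := by
  obtain ⟨w, h⟩ := h
  obtain ⟨hl⟩ := E.isCokernel h
  exact ⟨_, (CokernelCofork.IsColimit.desc' hl k hk).2⟩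

lemma mono (h : E.IsConflation i d) : Mono i := by
  obtain ⟨w, h⟩ := h
  obtain ⟨hl⟩ := E.isKernel h
  exact mono_of_isLimit_fork hl

lemma epi (h : E.IsConflation i d) : Epi d := by
  obtain ⟨w, h⟩ := h
  obtain ⟨hl⟩ := E.isCokernel h
  exact epi_of_isColimit_cofork hl

lemma of_iso (h : E.IsConflation i d) {X' Y' Z' : C} {i' : X' ⟶ Y'} {d' : Y' ⟶ Z'}
    (a : X ≅ X') (b : Y ≅ Y') (c : Z ≅ Z') (hi : a.hom ≫ i' = i ≫ b.hom)
    (hd : b.hom ≫ d' = d ≫ c.hom) : E.IsConflation i' d' := by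
  obtain ⟨w, h⟩ := h
  have w' : i' ≫ d' = 0 := by
    rw [← cancel_epi a.hom, reassoc_of% hi, hd, reassoc_of% w, zero_comp, comp_zero]
  exact ⟨w', E.conflation_of_iso (ShortComplex.isoMk a b c hi hd) h⟩

lemma of_epi (h : E.IsConflation i d) {Z' : C} {d' : Y ⟶ Z'} [Epi d'] (w : i ≫ d' = 0)
    {l : Z' ⟶ Z} (hl : d' ≫ l = d) : E.IsConflation i d' := by
  obtain ⟨m, hm⟩ := h.exists_desc d' w
  have := h.epi
  exact h.of_iso (Iso.refl _) (Iso.refl _)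
    ⟨m, l, by rw [← cancel_epi d, reassoc_of% hm, hl, Category.comp_id],
      by rw [← cancel_epi d', reassoc_of% hl, hm, Category.comp_id]⟩ (by simp) (by simp [hm])

lemma of_mono (h : E.IsConflation i d) {X' : C} {i' : X' ⟶ Y} [Mono i'] (w : i' ≫ d = 0)
    {l : X ⟶ X'} (hl : l ≫ i' = i) : E.IsConflation i' d := by
  obtain ⟨m, hm⟩ := h.exists_lift i' w
  have := h.mono
  exact h.of_iso ⟨l, m, by rw [← cancel_mono i, Category.assoc, hm, hl, Category.id_comp],
    by rw [← cancel_mono i', Category.assoc, hl, hm, Category.id_comp]⟩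
    (Iso.refl _) (Iso.refl _) (by simp [hl]) (by simp)

lemma inflation (h : E.IsConflation i d) : E.inflation i := ⟨Z, d, h⟩

lemma deflation (h : E.IsConflation i d) : E.deflation d := ⟨X, i, h⟩

/-- The axiom provides only some pushout that is an inflation. Any other is isomorphic to it, and
the induced map `d'` is an epimorphism through which the cokernel factors, hence itself the
cokernel. -/
lemma of_isPushout (h : E.IsConflation i d) {X' Y' : C} {a : X ⟶ X'} {b : Y ⟶ Y'} {i' : X' ⟶ Y'}
    (sq : IsPushout i a b i') {d' : Y' ⟶ Z} (hb : b ≫ d' = d) (hi : i' ≫ d' = 0) :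
    E.IsConflation i' d' := by
  obtain ⟨Y'', b'', i'', sq', Z'', d'', h''⟩ := E.pushout_inflation i a h.inflation
  change E.IsConflation i'' d'' at h''
  let e : Y'' ≅ Y' := sq'.isoIsPushout _ _ sq
  have h₁ : E.IsConflation i' (e.inv ≫ d'') :=
    h''.of_iso (Iso.refl _) e (Iso.refl _) (by simp [e]) (by simp)
  have := h.epi
  have : Epi (b ≫ d') := by rwa [hb]
  have : Epi d' := epi_of_epi b d'
  obtain ⟨l, hl⟩ := h.exists_desc (b ≫ e.inv ≫ d'') (by rw [sq.w_assoc, h₁.w, comp_zero])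
  refine h₁.of_epi hi (l := l) (sq.hom_ext ?_ ?_)
  · rw [reassoc_of% hb, hl]
  · rw [reassoc_of% hi, zero_comp, h₁.w]

lemma of_isPullback (h : E.IsConflation i d) {Y' Z' : C} {c : Z' ⟶ Z} {b : Y' ⟶ Y} {d' : Y' ⟶ Z'}
    (sq : IsPullback b d' d c) {i' : X ⟶ Y'} (hb : i' ≫ b = i) (hi : i' ≫ d' = 0) :
    E.IsConflation i' d' := by
  obtain ⟨Y'', b'', d'', sq', X'', i'', h''⟩ := E.pullback_deflation d c h.deflation
  change E.IsConflation i'' d'' at h''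
  let e : Y'' ≅ Y' := sq'.isoIsPullback _ _ sq
  have h₁ : E.IsConflation (i'' ≫ e.hom) d' :=
    h''.of_iso (Iso.refl _) e (Iso.refl _) (by simp) (by simp [e])
  have := h.mono
  have : Mono (i' ≫ b) := by rwa [hb]
  have : Mono i' := mono_of_mono i' b
  obtain ⟨l, hl⟩ := h.exists_lift ((i'' ≫ e.hom) ≫ b) (by
    rw [Category.assoc _ b, sq.w, ← Category.assoc _ d', h₁.w, zero_comp])
  refine h₁.of_mono hi (l := l) (sq.hom_ext ?_ ?_)
  · rw [Category.assoc, hb, hl]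
  · rw [Category.assoc, hi, comp_zero, h₁.w]

lemma exists_isPushout (h : E.IsConflation i d) {X' : C} (a : X ⟶ X') :
    ∃ (Y' : C) (b : Y ⟶ Y') (i' : X' ⟶ Y') (d' : Y' ⟶ Z),
      IsPushout i a b i' ∧ b ≫ d' = d ∧ E.IsConflation i' d' := by
  obtain ⟨Y', b, i', sq, -⟩ := E.pushout_inflation i a h.inflation
  refine ⟨Y', b, i', sq.desc d 0 (by rw [h.w, comp_zero]), sq, by simp, ?_⟩
  exact h.of_isPushout sq (by simp) (by simp)

lemma exists_isPullback (h : E.IsConflation i d) {Z' : C} (c : Z' ⟶ Z) :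
    ∃ (Y' : C) (b : Y' ⟶ Y) (d' : Y' ⟶ Z') (i' : X ⟶ Y'),
      IsPullback b d' d c ∧ i' ≫ b = i ∧ E.IsConflation i' d' := by
  obtain ⟨Y', b, d', sq, -⟩ := E.pullback_deflation d c h.deflation
  refine ⟨Y', b, d', sq.lift i 0 (by rw [h.w, zero_comp]), sq, by simp, ?_⟩
  exact h.of_isPullback sq (by simp) (by simp)

lemma exists_retraction_iff (h : E.IsConflation i d) :
    (∃ r, i ≫ r = 𝟙 X) ↔ ∃ s, s ≫ d = 𝟙 Z := by
  have := h.mono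
  have := h.epi
  constructor
  · rintro ⟨r, hr⟩
    obtain ⟨s, hs⟩ := h.exists_desc (𝟙 Y - r ≫ i) (by simp [reassoc_of% hr])
    exact ⟨s, by rw [← cancel_epi d, reassoc_of% hs]; simp [h.w]⟩
  · rintro ⟨s, hs⟩
    obtain ⟨r, hr⟩ := h.exists_lift (𝟙 Y - d ≫ s) (by simp [hs])
    exact ⟨r, by rw [← cancel_mono i, Category.assoc, hr]; simp [reassoc_of% h.w]⟩

end IsConflation

/-! ### Trivial and split conflations -/

lemma isConflation_id_left (X : C) {Z : C} (hZ : IsZero Z) (d : X ⟶ Z) :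
    E.IsConflation (𝟙 X) d := by
  obtain ⟨Z', d', h⟩ := E.id_inflation X
  change E.IsConflation (𝟙 X) d' at h
  have hd : d' = 0 := by simpa using h.w
  have := h.epi
  have : Epi d := ⟨fun _ _ _ => hZ.eq_of_src _ _⟩
  exact h.of_epi (hZ.eq_of_tgt _ _) (l := 0) (by simp [hd])

lemma isConflation_id_right (X : C) {Z : C} (hZ : IsZero Z) (i : Z ⟶ X) :
    E.IsConflation i (𝟙 X) := by
  obtain ⟨Z', i', h⟩ := E.id_deflation X
  change E.IsConflation i' (𝟙 X) at h
  have hi : i' = 0 := by simpa using h.w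
  have : Mono i := ⟨fun _ _ _ => hZ.eq_of_tgt _ _⟩
  exact h.of_mono (hZ.eq_of_src _ _) (l := 0) (by simp [hi])

/-- A split sequence is the pullback of `X ⟶ X ⟶ 0` along `Z ⟶ 0`. -/
lemma isConflation_of_split {X Y Z : C} {i : X ⟶ Y} {d : Y ⟶ Z} {r : Y ⟶ X} {s : Z ⟶ Y}
    (hi : i ≫ r = 𝟙 X) (hd : s ≫ d = 𝟙 Z) (w : i ≫ d = 0) (h : r ≫ i + d ≫ s = 𝟙 Y) :
    E.IsConflation i d := by
  -- Composing the splitting identity with `s` and `r` gives `s ≫ r + s ≫ r = s ≫ r`.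
  have hsr : s ≫ r = 0 := by
    have := s ≫= h =≫ r
    simpa [hi, reassoc_of% hd] using this
  have sq : IsPullback r d (0 : X ⟶ 0) (0 : Z ⟶ 0) :=
    IsPullback.of_isLimit' ⟨by simp⟩ (PullbackCone.IsLimit.mk _
      (fun t => t.fst ≫ i + t.snd ≫ s) (by simp [hi, hsr]) (by simp [w, hd]) (by
        intro t m h₁ h₂
        rw [← h₁, ← h₂]
        simp only [Category.assoc, ← Preadditive.comp_add, h, Category.comp_id]))
  exact (isConflation_id_left X (isZero_zero C) 0).of_isPullback sq hi w

lemma isConflation_inl_snd (X Y : C) :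
    E.IsConflation (biprod.inl : X ⟶ X ⊞ Y) biprod.snd :=
  isConflation_of_split biprod.inl_fst biprod.inr_snd biprod.inl_snd biprod.total

/-! ### Vanishing of `Ext¹` and lifting -/

/-- Being split is invariant under `Extension.Rel`, so it descends to the quotient, where it can be
compared with the class of the biproduct extension. -/
lemma ext1Vanishes_iff {A B : C} :
    E.Ext1Vanishes A B ↔ ∀ (M : C) (i : B ⟶ M) (d : M ⟶ A), E.IsConflation i d →
      ∃ r, i ≫ r = 𝟙 B := by
  constructor
  · intro h M i d hid
    let σ : E.Extension A B → Prop := fun ε => ∃ r, ε.i ≫ r = 𝟙 B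
    have hσ : ∀ ε ε' : E.Extension A B, Extension.Rel E ε ε' → σ ε = σ ε' := by
      rintro ε ε' ⟨φ, h₁, h₂⟩
      -- A morphism of extensions carries sections forward and retractions backward; the two are
      -- exchanged by `exists_retraction_iff`.
      refine propext ⟨fun hr => ?_, fun ⟨r, hr⟩ => ⟨φ ≫ r, by rw [reassoc_of% h₁, hr]⟩⟩
      have c : E.IsConflation ε.i ε.d := ⟨_, ε.conflation⟩
      have c' : E.IsConflation ε'.i ε'.d := ⟨_, ε'.conflation⟩
      obtain ⟨s, hs⟩ := c.exists_retraction_iff.1 hr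
      exact c'.exists_retraction_iff.2 ⟨s ≫ φ, by rw [Category.assoc, h₂, hs]⟩
    have c₀ := isConflation_inl_snd (E := E) B A
    let ε : E.Extension A B := ⟨M, i, d, hid.w, hid.choose_spec⟩
    let ε₀ : E.Extension A B := ⟨_, _, _, c₀.w, c₀.choose_spec⟩
    have := congrArg (Quot.lift σ hσ)
      (@Subsingleton.elim _ h (Quot.mk _ ε) (Quot.mk _ ε₀))
    change σ ε = σ ε₀ at this
    change σ ε
    rw [this]
    exact ⟨biprod.fst, biprod.inl_fst⟩
  · intro h
    refine ⟨fun x y => ?_⟩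
    induction x using Quot.inductionOn with | h ε => ?_
    induction y using Quot.inductionOn with | h ε' => ?_
    refine Quot.sound ?_
    have c : E.IsConflation ε.i ε.d := ⟨_, ε.conflation⟩
    have c' : E.IsConflation ε'.i ε'.d := ⟨_, ε'.conflation⟩
    obtain ⟨r, hr⟩ := h _ _ _ c
    obtain ⟨s, hs⟩ := c'.exists_retraction_iff.1 (h _ _ _ c')
    -- In terms of the splittings, this is the identity of `B ⊞ A`.
    exact ⟨r ≫ ε'.i + ε.d ≫ s, by simp [reassoc_of% hr, reassoc_of% ε.w],
      by simp [ε'.w, hs]⟩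

lemma ext1Vanishes_iff_section {A B : C} :
    E.Ext1Vanishes A B ↔ ∀ (M : C) (i : B ⟶ M) (d : M ⟶ A), E.IsConflation i d →
      ∃ s, s ≫ d = 𝟙 A := by
  rw [ext1Vanishes_iff]
  exact forall₄_congr fun _ _ _ h => h.exists_retraction_iff

lemma Ext1Vanishes.of_iso {A A' B B' : C} (h : E.Ext1Vanishes A B) (a : A ≅ A') (b : B ≅ B') :
    E.Ext1Vanishes A' B' := by
  rw [ext1Vanishes_iff] at h ⊢
  intro M i d hid
  obtain ⟨r, hr⟩ := h M (b.hom ≫ i) (d ≫ a.inv)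
    (hid.of_iso b.symm (Iso.refl _) a.symm (by simp) (by simp))
  exact ⟨r ≫ b.hom, by rw [← cancel_epi b.hom, reassoc_of% hr, Category.comp_id]⟩

/-- This is the lifting problem whose bottom map is the identity. The sought section amounts to a
retraction `P ⟶ B` of `i` that vanishes on `u`. Such a map is prescribed on the kernel `K` of `P ⟶
A`, which is `X ⊞ B`, and the obstruction to extending it to `P` lies in `Ext¹(A, B)`. -/
lemma exists_section_of_ext1Vanishes {X Y A B P : C} {f : X ⟶ Y} {d : Y ⟶ A} {i : B ⟶ P}
    {g : P ⟶ Y} (hf : E.IsConflation f d) (hg : E.IsConflation i g) (hAB : E.Ext1Vanishes A B)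
    {u : X ⟶ P} (hu : u ≫ g = f) : ∃ s : Y ⟶ P, s ≫ g = 𝟙 Y ∧ f ≫ s = u := by
  have := hf.mono
  have := hg.mono
  have := hg.epi
  obtain ⟨K, k, hk⟩ : ∃ (K : C) (k : K ⟶ P), E.IsConflation k (g ≫ d) :=
    E.comp_deflation g d hg.deflation hf.deflation
  have := hk.mono
  obtain ⟨u', hu'⟩ := hk.exists_lift u (by rw [reassoc_of% hu, hf.w])
  obtain ⟨i', hi'⟩ := hk.exists_lift i (by rw [reassoc_of% hg.w, zero_comp])
  obtain ⟨q, hq⟩ := hf.exists_lift (k ≫ g) (by rw [Category.assoc, hk.w])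
  -- `q` and `π` are the projections of `K` onto `X` and `B`, complementary to the inclusions `u'`
  -- and `i'`.
  obtain ⟨π, hπ⟩ := hg.exists_lift (k - q ≫ u) (by simp [hq, hu])
  have hiq : i' ≫ q = 0 := by
    rw [← cancel_mono f, Category.assoc, hq, reassoc_of% hi', hg.w, zero_comp]
  have huq : u' ≫ q = 𝟙 X := by
    rw [← cancel_mono f, Category.assoc, hq, reassoc_of% hu', hu, Category.id_comp]
  -- Pushing out along `π` gives an extension of `A` by `B`; its retraction `r` yields the extension
  -- `b ≫ r` of `π` to `P`.
  obtain ⟨M, b, j, d', sq, -, hj⟩ := hk.exists_isPushout π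
  obtain ⟨r, hr⟩ := ext1Vanishes_iff.1 hAB _ _ _ hj
  have hρ : k ≫ b ≫ r = π := by rw [sq.w_assoc, hr, Category.comp_id]
  have hi : i ≫ b ≫ r = 𝟙 B := by
    rw [← hi', Category.assoc, hρ, ← cancel_mono i, Category.assoc, hπ]
    simp [reassoc_of% hiq, hi']
  have hu₀ : u ≫ b ≫ r = 0 := by
    rw [← hu', Category.assoc, hρ, ← cancel_mono i, Category.assoc, hπ]
    simp [reassoc_of% huq, hu']
  obtain ⟨s, hs⟩ := hg.exists_desc (𝟙 P - (b ≫ r) ≫ i) (by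
    rw [Preadditive.comp_sub, ← Category.assoc i, hi]; simp)
  refine ⟨s, ?_, ?_⟩
  · rw [← cancel_epi g, reassoc_of% hs]
    simp [hg.w]
  · rw [← hu, Category.assoc, hs, Preadditive.comp_sub, ← Category.assoc u, hu₀]
    simp

lemma hasLiftingProperty_of_ext1Vanishes {X Y A B K L : C} {f : X ⟶ Y} {d : Y ⟶ A} {i : B ⟶ K}
    {g : K ⟶ L} (hf : E.IsConflation f d) (hg : E.IsConflation i g) (hAB : E.Ext1Vanishes A B) :
    HasLiftingProperty f g := by
  refine ⟨fun {a b} sq => ?_⟩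
  -- Pulling `g` back along `b` turns a lift into a section with prescribed restriction to `X`.
  obtain ⟨P, b', g', i', sq', -, hg'⟩ := hg.exists_isPullback b
  obtain ⟨s, hs, hs'⟩ := exists_section_of_ext1Vanishes hf hg' hAB (u := sq'.lift a f sq.w)
    (by simp)
  exact ⟨⟨⟨s ≫ b', by rw [reassoc_of% hs']; simp, by
    rw [Category.assoc, sq'.w, reassoc_of% hs]⟩⟩⟩

end ExactStructure

end QuillenExact

namespace QuillenExact

/-! ### Complements of split monomorphisms and split epimorphisms -/

section WeaklyIdempotentComplete

variable {C : Type u} [Category.{v} C] [Preadditive C]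

lemma IsWeaklyIdempotentComplete.exists_complement (hC : IsWeaklyIdempotentComplete C) {X Y : C}
    {i : X ⟶ Y} {r : Y ⟶ X} (hi : i ≫ r = 𝟙 X) :
    ∃ (Z : C) (d : Y ⟶ Z) (s : Z ⟶ Y), i ≫ d = 0 ∧ s ≫ d = 𝟙 Z ∧ r ≫ i + d ≫ s = 𝟙 Y := by
  have := hC i (IsSplitMono.mk' ⟨r, hi⟩)
  refine ⟨cokernel i, cokernel.π i, cokernel.desc i (𝟙 Y - r ≫ i) (by simp [reassoc_of% hi]),
    by simp, ?_, by simp⟩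
  rw [← cancel_epi (cokernel.π i)]
  simp

/-- Weak idempotent completeness is self-dual: the complement of the section `s` is also a kernel of
`d`. -/
lemma IsWeaklyIdempotentComplete.exists_complement' (hC : IsWeaklyIdempotentComplete C) {Y Z : C}
    {d : Y ⟶ Z} {s : Z ⟶ Y} (hd : s ≫ d = 𝟙 Z) :
    ∃ (X : C) (i : X ⟶ Y) (r : Y ⟶ X), i ≫ d = 0 ∧ i ≫ r = 𝟙 X ∧ r ≫ i + d ≫ s = 𝟙 Y := by
  obtain ⟨X, r, i, -, hi, h⟩ := hC.exists_complement hd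
  refine ⟨X, i, r, ?_, hi, by rw [add_comm, h]⟩
  have := i ≫= h =≫ d
  simpa [hd, reassoc_of% hi] using this

end WeaklyIdempotentComplete

/-! ### Functorial pushouts -/

section

variable {C : Type u} [Category.{v} C] {D : Type*} [Category* D] {F G H : D ⥤ C}

lemma exists_pushout_functor (α : F ⟶ G) (β : F ⟶ H)
    (h : ∀ X, HasPushout (α.app X) (β.app X)) :
    ∃ (Q : D ⥤ C) (b : G ⟶ Q) (j : H ⟶ Q),
      ∀ X, IsPushout (α.app X) (β.app X) (b.app X) (j.app X) := by
  have sq (X : D) := IsPushout.of_hasPushout (α.app X) (β.app X)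
  have w {X Y : D} (f : X ⟶ Y) : α.app X ≫ G.map f ≫ pushout.inl (α.app Y) (β.app Y) =
      β.app X ≫ H.map f ≫ pushout.inr (α.app Y) (β.app Y) := by
    rw [← α.naturality_assoc, ← β.naturality_assoc, pushout.condition]
  exact ⟨{ obj X := pushout (α.app X) (β.app X)
           map f := (sq _).desc _ _ (w f)
           map_id X := by apply (sq X).hom_ext <;> simp
           map_comp {X Y Z} f g := by
             apply (sq X).hom_ext
             · rw [IsPushout.inl_desc, IsPushout.inl_desc_assoc, Category.assoc,
                 IsPushout.inl_desc, G.map_comp, Category.assoc]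
             · rw [IsPushout.inr_desc, IsPushout.inr_desc_assoc, Category.assoc,
                 IsPushout.inr_desc, H.map_comp, Category.assoc] },
    { app X := pushout.inl _ _, naturality _ _ f := ((sq _).inl_desc _ _ (w f)).symm },
    { app X := pushout.inr _ _, naturality _ _ f := ((sq _).inr_desc _ _ (w f)).symm }, sq⟩

end

/-! ### Retracts of inflations and deflations -/

namespace ExactStructure

variable {C : Type u} [Category.{v} C] [Preadditive C] [HasFiniteBiproducts C]
variable {E : ExactStructure C}

attribute [local instance] hasBinaryBiproducts_of_finite_biproducts

/-- Write `W` as `Y ⊞ V`. The projection to `V` kills `f ≫ j`, hence factors through the cokernel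
`D'`, where it is again split, with kernel `D`. Pulling the conflation back along `D ⟶ D'` replaces
`W` by `Y` and exhibits `f` as an inflation. -/
lemma inflation_of_comp_section (hC : IsWeaklyIdempotentComplete C) {X Y W : C} {f : X ⟶ Y}
    {j : Y ⟶ W} {r : W ⟶ Y} (hj : j ≫ r = 𝟙 Y) (h : E.inflation (f ≫ j)) : E.inflation f := by
  obtain ⟨V, q, t, hq, ht, hqt⟩ := hC.exists_complement hj
  obtain ⟨D', e, he⟩ : ∃ (D' : C) (e : W ⟶ D'), E.IsConflation (f ≫ j) e := h
  obtain ⟨q', hq'⟩ := he.exists_desc q (by simp [hq])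
  obtain ⟨D, m, ρ, hm, hmρ, hρ⟩ := hC.exists_complement' (d := q') (s := t ≫ e)
    (by rw [Category.assoc, hq', ht])
  have hc : (j ≫ e ≫ ρ) ≫ m = j ≫ e := by
    have := (j ≫ e) ≫= hρ
    simpa [reassoc_of% hq', reassoc_of% hq] using this
  -- A map to `W` whose image in `D'` lies in `D` has no component in `V`, so it factors through
  -- `Y`.
  have key {T : C} (a : T ⟶ W) (b : T ⟶ D) (w : a ≫ e = b ≫ m) : a ≫ r ≫ j = a := by
    have haq : a ≫ q = 0 := by rw [← hq', reassoc_of% w, hm, comp_zero]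
    have := a ≫= hqt
    simpa [reassoc_of% haq] using this
  have sq : IsPullback j (j ≫ e ≫ ρ) e m :=
    IsPullback.of_isLimit' ⟨hc.symm⟩ (PullbackCone.IsLimit.mk _ (fun s => s.fst ≫ r)
      (fun s => by
        rw [Category.assoc]
        exact key _ _ s.condition)
      (fun s => by
        have := key _ _ s.condition =≫ (e ≫ ρ)
        simp only [Category.assoc] at this ⊢
        rw [this, s.condition_assoc, hmρ, Category.comp_id])
      (fun s l h₁ _ => by rw [← h₁, Category.assoc, hj, Category.comp_id]))
  have : IsSplitMono m := IsSplitMono.mk' ⟨ρ, hmρ⟩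
  exact (he.of_isPullback sq rfl (by
    rw [← cancel_mono m, Category.assoc, hc, ← Category.assoc, he.w, zero_comp])).inflation

lemma deflation_of_retraction_comp (hC : IsWeaklyIdempotentComplete C) {W Y Z : C} {p : W ⟶ Y}
    {g : Y ⟶ Z} {j : Y ⟶ W} (hj : j ≫ p = 𝟙 Y) (h : E.deflation (p ≫ g)) : E.deflation g := by
  obtain ⟨V, k, ρ, hk, hkρ, hρ⟩ := hC.exists_complement' hj
  obtain ⟨D', e, he⟩ : ∃ (D' : C) (e : D' ⟶ W), E.IsConflation e (p ≫ g) := h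
  obtain ⟨k', hk'⟩ := he.exists_lift k (by rw [reassoc_of% hk, zero_comp])
  obtain ⟨D, m, σ, hm, hσm, hσ⟩ := hC.exists_complement (i := k') (r := e ≫ ρ)
    (by rw [reassoc_of% hk', hkρ])
  have hc : m ≫ σ ≫ e ≫ p = e ≫ p := by
    have := hσ =≫ (e ≫ p)
    simpa [reassoc_of% hk', hk] using this
  have key {T : C} (a : W ⟶ T) (b : D ⟶ T) (w : e ≫ a = m ≫ b) : p ≫ j ≫ a = a := by
    have hka : k ≫ a = 0 := by rw [← hk', Category.assoc, w, reassoc_of% hm, zero_comp]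
    have := hρ =≫ a
    simpa [hka] using this
  have sq : IsPushout e m p (σ ≫ e ≫ p) :=
    IsPushout.of_isColimit' ⟨hc.symm⟩ (PushoutCocone.IsColimit.mk _ (fun s => j ≫ s.inl)
      (fun s => key _ _ s.condition)
      (fun s => by
        simp only [Category.assoc]
        rw [key _ _ s.condition, s.condition, reassoc_of% hσm])
      (fun s l h₁ _ => by rw [← h₁, reassoc_of% hj]))
  exact (he.of_isPushout sq rfl (by simp [he.w])).deflation

/-- The section on sources is a split inflation. Composed with `g` it gives `f` followed by the
section on targets, and that section can be cancelled. -/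
lemma inflation_isStableUnderRetracts (hC : IsWeaklyIdempotentComplete C) :
    E.inflation.IsStableUnderRetracts where
  of_retract {X Y Z W f g} h hg := by
    obtain ⟨V, d, s, hd, hs, hds⟩ := hC.exists_complement h.retract_left
    have hi : E.inflation h.i.left :=
      (isConflation_of_split h.retract_left hs hd hds).inflation
    refine inflation_of_comp_section hC h.retract_right ?_
    have := E.comp_inflation _ _ hi hg
    rw [h.i_w] at this
    exact this

lemma deflation_isStableUnderRetracts (hC : IsWeaklyIdempotentComplete C) :
    E.deflation.IsStableUnderRetracts where
  of_retract {X Y Z W f g} h hg := by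
    obtain ⟨V, i, r, hd, hr, hds⟩ := hC.exists_complement' h.retract_right
    have hi : E.deflation h.r.right :=
      (isConflation_of_split hr h.retract_right hd hds).deflation
    refine deflation_of_retraction_comp hC h.retract_left ?_
    have := E.comp_deflation _ _ hg hi
    rw [← h.r_w] at this
    exact this

/-! ### From complete cotorsion pairs to factorization systems -/

lemma inflClass_iff {A : ObjectProperty C} {X Y : C} (f : X ⟶ Y) :
    E.inflClass A f ↔ ∃ (Z : C) (d : Y ⟶ Z), E.IsConflation f d ∧ A Z :=
  ⟨fun ⟨Z, d, w, h, hZ⟩ => ⟨Z, d, ⟨w, h⟩, hZ⟩, fun ⟨Z, d, ⟨w, h⟩, hZ⟩ => ⟨Z, d, w, h, hZ⟩⟩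

lemma deflClass_iff {B : ObjectProperty C} {Y Z : C} (f : Y ⟶ Z) :
    E.deflClass B f ↔ ∃ (X : C) (i : X ⟶ Y), E.IsConflation i f ∧ B X :=
  ⟨fun ⟨Z, d, w, h, hZ⟩ => ⟨Z, d, ⟨w, h⟩, hZ⟩, fun ⟨Z, d, ⟨w, h⟩, hZ⟩ => ⟨Z, d, w, h, hZ⟩⟩

lemma leftPerp_of_hasLiftingProperty {B : ObjectProperty C} {X Y Z : C} {f : X ⟶ Y} {d : Y ⟶ Z}
    (h : E.IsConflation f d)
    (hf : ∀ {K L : C} (g : K ⟶ L), E.deflClass B g → HasLiftingProperty f g) :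
    E.leftPerp B Z := by
  intro B' hB
  rw [ext1Vanishes_iff_section]
  intro M i p hp
  have := hf p ((deflClass_iff p).2 ⟨_, _, hp, hB⟩)
  -- With zero on top, the lift kills `f` and descends to a section of `p`.
  have sq : CommSq (0 : X ⟶ M) f p d := ⟨by rw [h.w, zero_comp]⟩
  obtain ⟨s, hs⟩ := h.exists_desc sq.lift sq.fac_left
  have := h.epi
  exact ⟨s, by rw [← cancel_epi d, reassoc_of% hs, sq.fac_right, Category.comp_id]⟩

lemma rightPerp_of_hasLiftingProperty {A : ObjectProperty C} {X Y Z : C} {i : X ⟶ Y} {g : Y ⟶ Z}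
    (h : E.IsConflation i g)
    (hg : ∀ {K L : C} (f : K ⟶ L), E.inflClass A f → HasLiftingProperty f g) :
    E.rightPerp A X := by
  intro A' hA
  rw [ext1Vanishes_iff]
  intro M j q hq
  have := hg j ((inflClass_iff j).2 ⟨_, _, hq, hA⟩)
  have sq : CommSq i j g (0 : M ⟶ Z) := ⟨by rw [h.w, comp_zero]⟩
  obtain ⟨r, hr⟩ := h.exists_lift sq.lift sq.fac_right
  have := h.mono
  exact ⟨r, by rw [← cancel_mono i, Category.assoc, hr, sq.fac_left, Category.id_comp]⟩

namespace IsCompleteCotorsionPair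

variable {A B : ObjectProperty C} (h : E.IsCompleteCotorsionPair A B)

include h

lemma ext1Vanishes {X Y : C} (hX : A X) (hY : B Y) : E.Ext1Vanishes X Y := by
  have := h.left_eq ▸ hX
  exact this Y hY

lemma left_of_iso {X Y : C} (e : X ≅ Y) (hX : A X) : A Y := by
  rw [h.left_eq]
  exact fun Z hZ => (h.ext1Vanishes hX hZ).of_iso e (Iso.refl _)

lemma right_of_iso {X Y : C} (e : X ≅ Y) (hX : B X) : B Y := by
  rw [← h.right_eq]
  exact fun Z hZ => (h.ext1Vanishes hZ hX).of_iso (Iso.refl _) e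

lemma hasLiftingProperty {X Y K L : C} {f : X ⟶ Y} {g : K ⟶ L} (hf : E.inflClass A f)
    (hg : E.deflClass B g) : HasLiftingProperty f g := by
  obtain ⟨_, _, hf, hA⟩ := (inflClass_iff f).1 hf
  obtain ⟨_, _, hg, hB⟩ := (deflClass_iff g).1 hg
  exact hasLiftingProperty_of_ext1Vanishes hf hg (h.ext1Vanishes hA hB)

lemma inflClass_of_hasLiftingProperty {X Y : C} {f : X ⟶ Y} (hf : E.inflation f)
    (hf' : ∀ {K L : C} (g : K ⟶ L), E.deflClass B g → HasLiftingProperty f g) :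
    E.inflClass A f := by
  obtain ⟨Z, d, hd⟩ : ∃ (Z : C) (d : Y ⟶ Z), E.IsConflation f d := hf
  exact (inflClass_iff f).2 ⟨Z, d, hd, h.left_eq ▸ leftPerp_of_hasLiftingProperty hd hf'⟩

lemma deflClass_of_hasLiftingProperty {X Y : C} {g : X ⟶ Y} (hg : E.deflation g)
    (hg' : ∀ {K L : C} (f : K ⟶ L), E.inflClass A f → HasLiftingProperty f g) :
    E.deflClass B g := by
  obtain ⟨Z, i, hi⟩ : ∃ (Z : C) (i : Z ⟶ X), E.IsConflation i g := hg
  exact (deflClass_iff g).2 ⟨Z, i, hi, h.right_eq ▸ rightPerp_of_hasLiftingProperty hi hg'⟩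

/-- Among inflations, `Infl A` is characterized by lifting against `Defl B`, and lifting properties
compose. -/
lemma inflClass_comp {X Y Z : C} {f : X ⟶ Y} {g : Y ⟶ Z} (hf : E.inflClass A f)
    (hg : E.inflClass A g) : E.inflClass A (f ≫ g) := by
  have hf₀ : E.inflation f := by
    obtain ⟨_, _, hf, -⟩ := (inflClass_iff f).1 hf
    exact hf.inflation
  have hg₀ : E.inflation g := by
    obtain ⟨_, _, hg, -⟩ := (inflClass_iff g).1 hg
    exact hg.inflation
  refine h.inflClass_of_hasLiftingProperty (E.comp_inflation f g hf₀ hg₀) fun p hp => ?_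
  have := h.hasLiftingProperty hf hp
  have := h.hasLiftingProperty hg hp
  infer_instance

lemma cokerClass_inflClass : E.cokerClass (E.inflClass A) = A := by
  ext X
  constructor
  · rintro ⟨_, _, Z, f, d, w, hf, hd, ⟨e⟩⟩
    obtain ⟨Z', d', hd', hZ'⟩ := (inflClass_iff f).1 hf
    have hd : E.IsConflation f d := ⟨w, hd⟩
    obtain ⟨l, hl⟩ := hd.exists_desc d' hd'.w
    obtain ⟨m, hm⟩ := hd'.exists_desc d hd.w
    have := hd.epi
    have := hd'.epi
    let e' : Z' ≅ Z := ⟨m, l, by rw [← cancel_epi d', reassoc_of% hm, hl, Category.comp_id],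
      by rw [← cancel_epi d, reassoc_of% hl, hm, Category.comp_id]⟩
    exact h.left_of_iso (e' ≪≫ e.symm) hZ'
  · intro hX
    have h₀ := isConflation_id_right (E := E) X (isZero_zero C) 0
    exact ⟨0, X, X, 0, 𝟙 X, h₀.w, (inflClass_iff _).2 ⟨_, _, h₀, hX⟩, h₀.choose_spec,
      ⟨Iso.refl _⟩⟩

lemma kerClass_deflClass : E.kerClass (E.deflClass B) = B := by
  ext X
  constructor
  · rintro ⟨Z, _, _, i, f, w, hf, hi, ⟨e⟩⟩
    obtain ⟨Z', i', hi', hZ'⟩ := (deflClass_iff f).1 hf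
    have hi : E.IsConflation i f := ⟨w, hi⟩
    obtain ⟨l, hl⟩ := hi.exists_lift i' hi'.w
    obtain ⟨m, hm⟩ := hi'.exists_lift i hi.w
    have := hi.mono
    have := hi'.mono
    let e' : Z' ≅ Z := ⟨l, m, by rw [← cancel_mono i', Category.assoc, hm, hl, Category.id_comp],
      by rw [← cancel_mono i, Category.assoc, hl, hm, Category.id_comp]⟩
    exact h.right_of_iso (e' ≪≫ e.symm) hZ'
  · intro hX
    have h₀ := isConflation_id_left (E := E) X (isZero_zero C) 0
    exact ⟨X, X, 0, 𝟙 X, 0, h₀.w, (deflClass_iff _).2 ⟨_, _, h₀, hX⟩, h₀.choose_spec,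
      ⟨Iso.refl _⟩⟩

end IsCompleteCotorsionPair

/-- The map factors as `X ⊞ A ⟶ X ⊞ Y ⟶ Y`: the first factor is the pullback of `a` along the second
projection, the second is a split deflation. -/
lemma IsConflation.deflation_desc {B A Y : C} {b : B ⟶ A} {a : A ⟶ Y} (ha : E.IsConflation b a)
    {X : C} (f : X ⟶ Y) : E.deflation (biprod.desc f a) := by
  have h₁ : E.IsConflation (biprod.lift (𝟙 X) (-f)) (biprod.desc f (𝟙 Y)) :=
    isConflation_of_split (r := biprod.fst) (s := biprod.inr) (by simp) (by simp) (by simp)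
      (by ext <;> simp)
  have h₂ : E.IsConflation (b ≫ biprod.inr) (biprod.map (𝟙 X) a) :=
    ha.of_isPullback (b := biprod.snd) (c := biprod.snd)
      (IsPullback.of_isLimit' ⟨by simp⟩ (PullbackCone.IsLimit.mk _
        (fun s => biprod.lift (s.snd ≫ biprod.fst) s.fst) (by simp)
        (fun s => by ext <;> simp [s.condition])
        (fun s m hm₁ hm₂ => by
          ext
          · simp [← hm₂]
          · simp [hm₁])))
      (by simp) (by ext <;> simp [ha.w])
  have := E.comp_deflation _ _ h₂.deflation h₁.deflation
  have e : biprod.map (𝟙 X) a ≫ biprod.desc f (𝟙 Y) = biprod.desc f a := by ext <;> simp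
  rwa [e] at this

/-- The common core of the plain and the functorial factorization. A pushout preserves the cokernels
of both sides: `b` has the cokernel `A₂` of `i`, and `j` has the cokernel `Y` of `k`, so `p` is a
deflation with kernel `B₂`. -/
lemma IsCompleteCotorsionPair.factorization_of_isPushout {A B : ObjectProperty C}
    (h : E.IsCompleteCotorsionPair A B) {X Y P A₁ B₂ A₂ K Q : C} {s : X ⟶ P} {t : P ⟶ A₁}
    {g : P ⟶ Y} {k : K ⟶ P} {i : K ⟶ B₂} {d : B₂ ⟶ A₂} (hs : E.IsConflation s t)
    (hk : E.IsConflation k g) (hi : E.IsConflation i d) (hA₁ : A A₁) (hA₂ : A A₂) (hB₂ : B B₂)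
    {b : P ⟶ Q} {j : B₂ ⟶ Q} (sq : IsPushout k i b j) {p : Q ⟶ Y}
    (hb : b ≫ p = g) (hj : j ≫ p = 0) :
    E.inflClass A (s ≫ b) ∧ E.deflClass B p := by
  refine ⟨h.inflClass_comp ?_ ?_, ?_⟩
  · exact (inflClass_iff _).2 ⟨_, _, hs, hA₁⟩
  · refine (inflClass_iff _).2 ⟨_, sq.desc 0 d (by rw [hi.w, comp_zero]), ?_, hA₂⟩
    exact hi.of_isPushout sq.flip (by simp) (by simp)
  · exact (deflClass_iff _).2 ⟨_, _, hk.of_isPushout sq hb hj, hB₂⟩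

lemma IsCompleteCotorsionPair.hasFactorization {A B : ObjectProperty C}
    (h : E.IsCompleteCotorsionPair A B) :
    (E.inflClass A).HasFactorization (E.deflClass B) where
  nonempty_mapFactorizationData {X Y} f := by
    obtain ⟨B₁, A₁, b₁, a, w₁, h₁, hA₁, -⟩ := h.approx_left Y
    have h₁ : E.IsConflation b₁ a := ⟨w₁, h₁⟩
    obtain ⟨K, k, hk⟩ : ∃ (K : C) (k : K ⟶ X ⊞ A₁), E.IsConflation k (biprod.desc f a) :=
      h₁.deflation_desc f
    obtain ⟨B₂, A₂, i, d, w₂, h₂, hA₂, hB₂⟩ := h.approx_right K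
    have h₂ : E.IsConflation i d := ⟨w₂, h₂⟩
    obtain ⟨Q, b, j, p, sq, hb, hj⟩ := hk.exists_isPushout i
    obtain ⟨hL, hR⟩ := h.factorization_of_isPushout (isConflation_inl_snd X A₁) hk h₂ hA₁ hA₂ hB₂ sq hb hj.w
    exact ⟨⟨Q, biprod.inl ≫ b, p, by simp [hb], hL, hR⟩⟩

/-! ### Functorial factorizations -/

section Functors

variable {D : Type*} [Category* D] {F G : D ⥤ C}

/-- Kernels may be chosen arbitrarily on objects; since they are monomorphisms, the induced maps are
unique and therefore functorial. -/
lemma exists_kernel_functor (p : F ⟶ G) (hp : ∀ X, E.deflation (p.app X)) :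
    ∃ (K : D ⥤ C) (k : K ⟶ F), ∀ X, E.IsConflation (k.app X) (p.app X) := by
  choose K k h using fun X => show ∃ (K : C) (k : K ⟶ F.obj X), E.IsConflation k (p.app X) from hp X
  have := fun X => (h X).mono
  choose m hm using fun {X Y : D} (f : X ⟶ Y) => (h Y).exists_lift (k X ≫ F.map f)
    (by rw [Category.assoc, p.naturality, reassoc_of% (h X).w, zero_comp])
  exact ⟨{ obj := K
           map f := m f
           map_id X := by rw [← cancel_mono (k X), hm]; simp
           map_comp f g := by
             rw [← cancel_mono (k _), hm, Category.assoc, hm, reassoc_of% hm, F.map_comp] },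
    { app := k, naturality _ _ f := hm f }, h⟩

lemma exists_cokernel_functor (i : F ⟶ G) (hi : ∀ X, E.inflation (i.app X)) :
    ∃ (Q : D ⥤ C) (q : G ⟶ Q), ∀ X, E.IsConflation (i.app X) (q.app X) := by
  choose Q q h using fun X => show ∃ (Q : C) (q : G.obj X ⟶ Q), E.IsConflation (i.app X) q from hi X
  have := fun X => (h X).epi
  choose m hm using fun {X Y : D} (f : X ⟶ Y) => (h X).exists_desc (G.map f ≫ q Y)
    (by rw [← i.naturality_assoc, (h Y).w, comp_zero])
  exact ⟨{ obj := Q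
           map f := m f
           map_id X := by rw [← cancel_epi (q X), hm]; simp
           map_comp f g := by
             rw [← cancel_epi (q _), hm, reassoc_of% hm, hm, G.map_comp, Category.assoc] },
    { app := q, naturality _ _ f := (hm f).symm }, h⟩

end Functors

lemma exists_functorial_inflation_deflation {B A : C ⥤ C} {b : B ⟶ A} {a : A ⟶ 𝟭 C}
    (h : ∀ X, E.IsConflation (b.app X) (a.app X)) :
    ∃ (P : Arrow C ⥤ C) (s : Arrow.leftFunc ⟶ P) (p : P ⟶ Arrow.rightFunc),
      ∀ f : Arrow C, s.app f ≫ p.app f = f.hom ∧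
        (∃ t : P.obj f ⟶ A.obj f.right, E.IsConflation (s.app f) t) ∧ E.deflation (p.app f) := by
  have nat {f g : Arrow C} (φ : f ⟶ g) :
      biprod.map φ.left (A.map φ.right) ≫ biprod.desc g.hom (a.app g.right) =
        biprod.desc f.hom (a.app f.right) ≫ φ.right := by
    have : A.map φ.right ≫ a.app g.right = a.app f.right ≫ φ.right := a.naturality φ.right
    apply biprod.hom_ext'
    · rw [biprod.inl_map_assoc, biprod.inl_desc, biprod.inl_desc_assoc, Arrow.w]
    · rw [biprod.inr_map_assoc, biprod.inr_desc, biprod.inr_desc_assoc, this]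
  exact ⟨{ obj f := f.left ⊞ A.obj f.right
           map φ := biprod.map φ.left (A.map φ.right)
           map_id f := by ext <;> simp
           map_comp φ ψ := by ext <;> simp },
    { app f := biprod.inl, naturality _ _ φ := (biprod.inl_map _ _).symm },
    { app f := biprod.desc f.hom (a.app f.right), naturality _ _ φ := nat φ },
    fun f => ⟨biprod.inl_desc _ _, ⟨biprod.snd, isConflation_inl_snd _ _⟩,
      (h f.right).deflation_desc f.hom⟩⟩

lemma IsFunctoriallyCompleteCotorsionPair.hasFunctorialFactorization {A B : ObjectProperty C}
    (h : E.IsFunctoriallyCompleteCotorsionPair A B) :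
    (E.inflClass A).HasFunctorialFactorization (E.deflClass B) := by
  obtain ⟨B₁, A₁, b₁, a, w₁, h₁⟩ := h.functorial_left
  obtain ⟨B₂, A₂, i, d, w₂, h₂⟩ := h.functorial_right
  have c₁ (X : C) : E.IsConflation (b₁.app X) (a.app X) := ⟨w₁ X, (h₁ X).1⟩
  have c₂ (X : C) : E.IsConflation (i.app X) (d.app X) := ⟨w₂ X, (h₂ X).1⟩
  obtain ⟨P, s, p₀, hP⟩ := exists_functorial_inflation_deflation c₁
  obtain ⟨K, k, hk⟩ := exists_kernel_functor (E := E) p₀ fun f => (hP f).2.2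
  obtain ⟨Q, b, j, sq⟩ := exists_pushout_functor k (Functor.whiskerLeft K i) fun f => by
    obtain ⟨_, _, _, _, sq, -⟩ := (hk f).exists_isPushout (i.app (K.obj f))
    exact sq.hasPushout
  have w (f : Arrow C) : k.app f ≫ p₀.app f = i.app (K.obj f) ≫ 0 := by
    rw [(hk f).w, comp_zero]
  let p : Q ⟶ Arrow.rightFunc :=
    { app f := (sq f).desc (p₀.app f) 0 (w f)
      naturality f g φ := by
        refine (sq f).hom_ext ?_ ?_
        · rw [← b.naturality_assoc, IsPushout.inl_desc, IsPushout.inl_desc_assoc, p₀.naturality]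
        · rw [← j.naturality_assoc, IsPushout.inr_desc, IsPushout.inr_desc_assoc]
          simp }
  have key (f : Arrow C) : E.inflClass A ((s ≫ b).app f) ∧ E.deflClass B (p.app f) :=
    h.factorization_of_isPushout (hP f).2.1.choose_spec (hk f) (c₂ _) (h₁ _).2.1 (h₂ _).2.1 (h₂ _).2.2 (sq f)
      ((sq f).inl_desc _ _ _) ((sq f).inr_desc _ _ _)
  refine ⟨⟨{ Z := Q, i := s ≫ b, p := p, fac := ?_, hi f := (key f).1, hp f := (key f).2 }⟩⟩
  ext f
  change (s.app f ≫ b.app f) ≫ (sq f).desc (p₀.app f) 0 (w f) = f.hom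
  rw [Category.assoc, IsPushout.inl_desc, (hP f).1]

lemma IsCompleteCotorsionPair.isExactWFS (hC : IsWeaklyIdempotentComplete C)
    {A B : ObjectProperty C} (h : E.IsCompleteCotorsionPair A B) :
    E.IsExactWFS (E.inflClass A) (E.deflClass B) where
  retract_left := ⟨fun {X Y Z W f g} r hg => by
    have := inflation_isStableUnderRetracts (E := E) hC
    refine h.inflClass_of_hasLiftingProperty (this.of_retract r ?_) fun p hp => ?_
    · obtain ⟨_, _, hg, -⟩ := (inflClass_iff g).1 hg
      exact hg.inflation
    · have := h.hasLiftingProperty hg hp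
      exact r.leftLiftingProperty p⟩
  retract_right := ⟨fun {X Y Z W f g} r hg => by
    have := deflation_isStableUnderRetracts (E := E) hC
    refine h.deflClass_of_hasLiftingProperty (this.of_retract r ?_) fun p hp => ?_
    · obtain ⟨_, _, hg, -⟩ := (deflClass_iff g).1 hg
      exact hg.deflation
    · have := h.hasLiftingProperty hp hg
      exact r.rightLiftingProperty p⟩
  lifting _ _ hf hg := h.hasLiftingProperty hf hg
  factorization := h.hasFactorization
  left_iff f := by
    refine exists_congr fun Z => exists_congr fun d => exists_congr fun w =>
      and_congr_right fun _ => ⟨fun hZ => ?_, fun hZ => ?_⟩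
    · exact (inflClass_iff _).2 ⟨Z, 𝟙 Z, isConflation_id_right Z (isZero_zero C) 0, hZ⟩
    · have h₀ := isConflation_id_right (E := E) Z (isZero_zero C) 0
      rw [← h.cokerClass_inflClass]
      exact ⟨_, _, _, _, _, h₀.w, hZ, h₀.choose_spec, ⟨Iso.refl _⟩⟩
  right_iff f := by
    refine exists_congr fun Z => exists_congr fun d => exists_congr fun w =>
      and_congr_right fun _ => ⟨fun hZ => ?_, fun hZ => ?_⟩
    · exact (deflClass_iff _).2 ⟨Z, 𝟙 Z, isConflation_id_left Z (isZero_zero C) 0, hZ⟩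
    · have h₀ := isConflation_id_left (E := E) Z (isZero_zero C) 0
      rw [← h.kerClass_deflClass]
      exact ⟨_, _, _, _, _, h₀.w, hZ, h₀.choose_spec, ⟨Iso.refl _⟩⟩

/-! ### From exact factorization systems to complete cotorsion pairs -/

lemma IsConflation.cokerClass {X Y Z : C} {f : X ⟶ Y} {d : Y ⟶ Z} (hd : E.IsConflation f d)
    {L : MorphismProperty C} (hf : L f) : E.cokerClass L Z :=
  ⟨_, _, _, f, d, hd.w, hf, hd.choose_spec, ⟨Iso.refl _⟩⟩

lemma IsConflation.kerClass {X Y Z : C} {i : X ⟶ Y} {f : Y ⟶ Z} (hi : E.IsConflation i f)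
    {R : MorphismProperty C} (hf : R f) : E.kerClass R X :=
  ⟨_, _, _, i, f, hi.w, hf, hi.choose_spec, ⟨Iso.refl _⟩⟩

namespace IsExactWFS

variable {L R : MorphismProperty C} (h : E.IsExactWFS L R)

include h

lemma left_iff' {X Y : C} (f : X ⟶ Y) :
    L f ↔ ∃ (Z : C) (d : Y ⟶ Z), E.IsConflation f d ∧ L (0 : (0 : C) ⟶ Z) := by
  rw [h.left_iff]
  exact ⟨fun ⟨Z, d, w, h, hZ⟩ => ⟨Z, d, ⟨w, h⟩, hZ⟩, fun ⟨Z, d, ⟨w, h⟩, hZ⟩ => ⟨Z, d, w, h, hZ⟩⟩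

lemma right_iff' {Y Z : C} (f : Y ⟶ Z) :
    R f ↔ ∃ (X : C) (i : X ⟶ Y), E.IsConflation i f ∧ R (0 : X ⟶ (0 : C)) := by
  rw [h.right_iff]
  exact ⟨fun ⟨Z, d, w, h, hZ⟩ => ⟨Z, d, ⟨w, h⟩, hZ⟩, fun ⟨Z, d, ⟨w, h⟩, hZ⟩ => ⟨Z, d, w, h, hZ⟩⟩

lemma cokerClass_iff (X : C) : E.cokerClass L X ↔ L (0 : (0 : C) ⟶ X) := by
  constructor
  · rintro ⟨_, _, Z, f, d, w, hf, hd, ⟨e⟩⟩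
    obtain ⟨Z', d', hd', hZ'⟩ := (h.left_iff' f).1 hf
    have hd : E.IsConflation f d := ⟨w, hd⟩
    have := hd.epi
    have := hd'.epi
    obtain ⟨l, hl⟩ := hd.exists_desc d' hd'.w
    obtain ⟨m, hm⟩ := hd'.exists_desc d hd.w
    have := h.retract_left
    -- Exactness speaks of one cokernel `Z'` of `f`; closure under retracts transfers membership to
    -- the isomorphic object.
    refine MorphismProperty.of_retract (g := (0 : (0 : C) ⟶ Z'))
      { i := Arrow.homMk (𝟙 _) (e.hom ≫ l) (by simp)
        r := Arrow.homMk (𝟙 _) (m ≫ e.inv) (by simp)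
        retract := ?_ } hZ'
    have hlm : l ≫ m = 𝟙 Z := by rw [← cancel_epi d, reassoc_of% hl, hm, Category.comp_id]
    ext <;> simp [reassoc_of% hlm]
  · intro hX
    have h₀ := isConflation_id_right (E := E) X (isZero_zero C) 0
    exact ⟨0, X, X, 0, 𝟙 X, h₀.w, hX, h₀.choose_spec, ⟨Iso.refl _⟩⟩

lemma kerClass_iff (X : C) : E.kerClass R X ↔ R (0 : X ⟶ (0 : C)) := by
  constructor
  · rintro ⟨Z, _, _, i, f, w, hf, hi, ⟨e⟩⟩
    obtain ⟨Z', i', hi', hZ'⟩ := (h.right_iff' f).1 hf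
    have hi : E.IsConflation i f := ⟨w, hi⟩
    have := hi.mono
    have := hi'.mono
    obtain ⟨l, hl⟩ := hi.exists_lift i' hi'.w
    obtain ⟨m, hm⟩ := hi'.exists_lift i hi.w
    have := h.retract_right
    refine MorphismProperty.of_retract (g := (0 : Z' ⟶ (0 : C)))
      { i := Arrow.homMk (e.hom ≫ m) (𝟙 _) (by simp)
        r := Arrow.homMk (l ≫ e.inv) (𝟙 _) (by simp)
        retract := ?_ } hZ'
    have hml : m ≫ l = 𝟙 Z := by
      rw [← cancel_mono i, Category.assoc, hl, hm, Category.id_comp]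
    ext <;> simp [reassoc_of% hml]
  · intro hX
    have h₀ := isConflation_id_left (E := E) X (isZero_zero C) 0
    exact ⟨X, X, 0, 𝟙 X, 0, h₀.w, hX, h₀.choose_spec, ⟨Iso.refl _⟩⟩

lemma inflClass_cokerClass : E.inflClass (E.cokerClass L) = L := by
  ext X Y f
  rw [inflClass_iff, h.left_iff']
  simp only [h.cokerClass_iff]

lemma deflClass_kerClass : E.deflClass (E.kerClass R) = R := by
  ext X Y f
  rw [deflClass_iff, h.right_iff']
  simp only [h.kerClass_iff]

lemma ext1Vanishes {A B : C} (hA : E.cokerClass L A) (hB : E.kerClass R B) :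
    E.Ext1Vanishes A B := by
  refine leftPerp_of_hasLiftingProperty (isConflation_id_right A (isZero_zero C) 0)
    (B := E.kerClass R) (fun g hg => ?_) B hB
  rw [h.deflClass_kerClass] at hg
  exact h.lifting _ _ ((h.cokerClass_iff A).1 hA) hg

/-- For the orthogonality equalities, factor `0 ⟶ X` as `0 ⟶ M ⟶ X`. If `X` is left orthogonal to
`Ker R`, the deflation `M ⟶ X` splits and `0 ⟶ X` is a retract of `0 ⟶ M`, hence in `L`. The other
side is dual, and the same factorizations are the approximation sequences. -/
lemma isCompleteCotorsionPair : E.IsCompleteCotorsionPair (E.cokerClass L) (E.kerClass R) where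
  left_eq := by
    ext X
    refine ⟨fun hX B hB => h.ext1Vanishes hX hB, fun hX => ?_⟩
    rw [h.cokerClass_iff]
    obtain ⟨M, i, p, fac, hi, hp⟩ :=
      (h.factorization.nonempty_mapFactorizationData (0 : (0 : C) ⟶ X)).some
    obtain ⟨K, k, hk, hK⟩ := (h.right_iff' p).1 hp
    obtain ⟨s, hs⟩ := ext1Vanishes_iff_section.1 (hX K ((h.kerClass_iff K).2 hK)) _ _ _ hk
    have := h.retract_left
    exact MorphismProperty.of_retract (g := i)
      { i := Arrow.homMk (𝟙 _) s ((isZero_zero C).eq_of_src _ _)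
        r := Arrow.homMk (𝟙 _) p ((isZero_zero C).eq_of_src _ _)
        retract := by ext <;> simp [hs] } hi
  right_eq := by
    ext X
    refine ⟨fun hX => ?_, fun hX A hA => h.ext1Vanishes hA hX⟩
    rw [h.kerClass_iff]
    obtain ⟨M, i, p, fac, hi, hp⟩ :=
      (h.factorization.nonempty_mapFactorizationData (0 : X ⟶ (0 : C))).some
    obtain ⟨K, k, hk, hK⟩ := (h.left_iff' i).1 hi
    obtain ⟨r, hr⟩ := ext1Vanishes_iff.1 (hX K ((h.cokerClass_iff K).2 hK)) _ _ _ hk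
    have := h.retract_right
    exact MorphismProperty.of_retract (g := p)
      { i := Arrow.homMk i (𝟙 _) ((isZero_zero C).eq_of_tgt _ _)
        r := Arrow.homMk r (𝟙 _) ((isZero_zero C).eq_of_tgt _ _)
        retract := by ext <;> simp [hr] } hp
  approx_right X := by
    obtain ⟨M, i, p, fac, hi, hp⟩ :=
      (h.factorization.nonempty_mapFactorizationData (0 : X ⟶ (0 : C))).some
    obtain ⟨K, k, hk, hK⟩ := (h.left_iff' i).1 hi
    refine ⟨M, K, i, k, hk.w, hk.choose_spec, (h.cokerClass_iff K).2 hK, ?_⟩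
    rw [h.kerClass_iff]
    rwa [(isZero_zero C).eq_of_tgt p 0] at hp
  approx_left X := by
    obtain ⟨M, i, p, fac, hi, hp⟩ :=
      (h.factorization.nonempty_mapFactorizationData (0 : (0 : C) ⟶ X)).some
    obtain ⟨K, k, hk, hK⟩ := (h.right_iff' p).1 hp
    refine ⟨K, M, k, p, hk.w, hk.choose_spec, ?_, (h.kerClass_iff K).2 hK⟩
    rw [h.cokerClass_iff]
    rwa [(isZero_zero C).eq_of_src i 0] at hi

end IsExactWFS

lemma IsExactFunctorialWFS.isFunctoriallyCompleteCotorsionPair {L R : MorphismProperty C}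
    (h : E.IsExactFunctorialWFS L R) :
    E.IsFunctoriallyCompleteCotorsionPair (E.cokerClass L) (E.kerClass R) where
  toIsCompleteCotorsionPair := h.toIsExactWFS.isCompleteCotorsionPair
  functorial_right := by
    obtain ⟨⟨Z, i, p, fac, hi, hp⟩⟩ := h.functorial
    -- Restricting the functorial factorization along `X ↦ (X ⟶ 0)` makes the approximation
    -- functorial in `X`.
    let T : C ⥤ Arrow C :=
      { obj X := Arrow.mk (0 : X ⟶ (0 : C))
        map f := Arrow.homMk f (𝟙 _) (by simp) }
    let i' : 𝟭 C ⟶ T ⋙ Z :=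
      { app X := i.app (T.obj X)
        naturality X Y f := i.naturality (T.map f) }
    obtain ⟨Q, q, hq⟩ := exists_cokernel_functor (E := E) i' fun X => by
      obtain ⟨_, _, hd, -⟩ := (h.left_iff' _).1 (hi (T.obj X))
      exact hd.inflation
    refine ⟨_, _, i', q, fun X => (hq X).w, fun X => ⟨(hq X).choose_spec,
      (hq X).cokerClass (hi _), ?_⟩⟩
    rw [h.kerClass_iff]
    have := hp (T.obj X)
    rwa [(isZero_zero C).eq_of_tgt (p.app (T.obj X)) 0] at this
  functorial_left := by
    obtain ⟨⟨Z, i, p, fac, hi, hp⟩⟩ := h.functorial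
    let T : C ⥤ Arrow C :=
      { obj X := Arrow.mk (0 : (0 : C) ⟶ X)
        map f := Arrow.homMk (𝟙 _) f (by simp) }
    let p' : T ⋙ Z ⟶ 𝟭 C :=
      { app X := p.app (T.obj X)
        naturality X Y f := p.naturality (T.map f) }
    obtain ⟨K, k, hk⟩ := exists_kernel_functor (E := E) p' fun X => by
      obtain ⟨_, _, hd, -⟩ := (h.right_iff' _).1 (hp (T.obj X))
      exact hd.deflation
    refine ⟨_, _, k, p', fun X => (hk X).w, fun X => ⟨(hk X).choose_spec, ?_,
      (hk X).kerClass (hp _)⟩⟩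
    rw [h.cokerClass_iff]
    have := hi (T.obj X)
    rwa [(isZero_zero C).eq_of_src (i.app (T.obj X)) 0] at this

end ExactStructure

end QuillenExact

/-! ### The correspondence -/

theorem mainTheorem6 {C : Type u} [Category.{v} C] [Preadditive C] [HasFiniteBiproducts C]
    (E : QuillenExact.ExactStructure C) :
    -- over an arbitrary exact category
    (Set.MapsTo E.cokerKer E.exactWFS E.completeCotorsionPairs ∧
      Set.MapsTo E.cokerKer E.exactFunctorialWFS E.functoriallyCompleteCotorsionPairs ∧
      Set.LeftInvOn E.inflDefl E.cokerKer E.exactWFS ∧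
      Set.RightInvOn E.inflDefl E.cokerKer E.completeCotorsionPairs) ∧
    -- over a weakly idempotent complete exact category
    (QuillenExact.IsWeaklyIdempotentComplete C →
      (Set.BijOn E.cokerKer E.exactWFS E.completeCotorsionPairs ∧
        Set.BijOn E.inflDefl E.completeCotorsionPairs E.exactWFS ∧
        Set.InvOn E.inflDefl E.cokerKer E.exactWFS E.completeCotorsionPairs) ∧
      (Set.BijOn E.cokerKer E.exactFunctorialWFS E.functoriallyCompleteCotorsionPairs ∧
        Set.BijOn E.inflDefl E.functoriallyCompleteCotorsionPairs E.exactFunctorialWFS ∧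
        Set.InvOn E.inflDefl E.cokerKer
          E.exactFunctorialWFS E.functoriallyCompleteCotorsionPairs)) := by
  have h₁ : Set.MapsTo E.cokerKer E.exactWFS E.completeCotorsionPairs :=
    fun _ hp => hp.isCompleteCotorsionPair
  have h₂ : Set.MapsTo E.cokerKer E.exactFunctorialWFS E.functoriallyCompleteCotorsionPairs :=
    fun _ hp => hp.isFunctoriallyCompleteCotorsionPair
  have h₃ : Set.LeftInvOn E.inflDefl E.cokerKer E.exactWFS :=
    fun _ hp => Prod.ext hp.inflClass_cokerClass hp.deflClass_kerClass
  have h₄ : Set.RightInvOn E.inflDefl E.cokerKer E.completeCotorsionPairs :=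
    fun _ hp => Prod.ext hp.cokerClass_inflClass hp.kerClass_deflClass
  refine ⟨⟨h₁, h₂, h₃, h₄⟩, fun hC => ?_⟩
  have h₅ : Set.MapsTo E.inflDefl E.completeCotorsionPairs E.exactWFS :=
    fun _ hp => hp.isExactWFS hC
  have h₆ : Set.MapsTo E.inflDefl E.functoriallyCompleteCotorsionPairs E.exactFunctorialWFS :=
    fun _ hp => ⟨hp.isExactWFS hC, hp.hasFunctorialFactorization⟩
  have inv : Set.InvOn E.inflDefl E.cokerKer E.exactWFS E.completeCotorsionPairs := ⟨h₃, h₄⟩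
  have inv' : Set.InvOn E.inflDefl E.cokerKer E.exactFunctorialWFS
      E.functoriallyCompleteCotorsionPairs :=
    inv.mono (fun _ hp => hp.toIsExactWFS) (fun _ hp => hp.toIsCompleteCotorsionPair)
  exact ⟨⟨inv.bijOn h₁ h₅, inv.symm.bijOn h₅ h₁, inv⟩,
    ⟨inv'.bijOn h₂ h₆, inv'.symm.bijOn h₆ h₂, inv'⟩⟩
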